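/- Let $p$ be a rational prime that is also a Gaussian prime (equivalently, a prime $p\equiv 3 \pmod 4$), put $q=p^3$ and $\mathbb{Z}_q=\mathbb{Z}/q\mathbb{Z}$, and for $v=(v_1,v_2)\in\mathbb{Z}_q^2$ write $\|v\|=v_1^2+v_2^2\in\mathbb{Z}_q$. For $x,y\in\mathbb{Z}_q^2$ let $B(x,y)=\{z\in\mathbb{Z}_q^2:\|z-x\|=\|z-y\|\}$. A subset of $\mathbb{Z}_q^2$ is called a non-isotropic line if it is of the form $\{(s,t):as+bt=c\}$ with $a$, $b$ and $a^2+b^2$ units of $\mathbb{Z}_q$. A reflection is a map $v\mapsto S(v-u)+u$ with $u\in\mathbb{Z}_q^2$ and $S=\begin{pmatrix}a&b\\b&-a\end{pmatrix}$, $a^2+b^2=1$; its axis is its set of fixed points. For $x=(x_1,x_2)$ and $y=(y_1,y_2)$ in $\mathbb{Z}_q^2\times\mathbb{Z}_q^2$, let $\mathcal{N}(x,y)$ be the number of pairs $(\mathcal{R}_1,\mathcal{R}_2)$ of reflections whose axes are non-isotropic lines such that $y_i=\mathcal{R}_2(\mathcal{R}_1(x_i))$ for $i=1,2$, and let $\mathcal{A}_x(n)=|\{y\in\mathbb{Z}_q^2\times\mathbb{Z}_q^2:\mathcal{N}(x,y)=n\}|$.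 Conjecture for $p$: for every $x=(x_1,x_2)\in\mathbb{Z}_q^2\times\mathbb{Z}_q^2$ such that $\|x_1-x_2\|$ is a unit, the values of $\mathcal{A}_x(n)$ at positive integers $n$ are \[\begin{array}{lll} \mathcal{A}_x(p^3-3p^2)=p^9-p^8,&\mathcal{A}_x(p^3-p^2)=p^8,&\mathcal{A}_x(p^3)=p^8-2p^7+p^6,\\ \mathcal{A}_x(p^4-p^3)=p^6-p^5,&\mathcal{A}_x(p^4)=p^5-2p^4+p^3,&\mathcal{A}_x(p^5-p^4)=p^3-p^2,\\ \mathcal{A}_x(p^5)=p^2-2p+1,&\mathcal{A}_x(p^6-p^5)=1,& \end{array}\] and $\mathcal{A}_x(n)=0$ for all other positive integers $n$ (for $p=3$ the first equation, where $p^3-3p^2=0$, is omitted). For $P\subseteq\mathbb{Z}_q^2$ and $d\in\mathbb{Z}_q^*$ define \[\begin{aligned} \widetilde{P}&=\{(x,y)\in P^2: \text{both coordinates of } x-y \text{ are units}\},\\ \Pi_d'&=\{(x,y)\in\widetilde{P}:\|x-y\|=d\},\\ Q_d'&=\{(x,y,z,w): (x,y),(z,w)\in\widetilde{P},\ B(x,z)=B(y,w)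 \text{ is a non-isotropic line},\ \|x-y\|=\|z-w\|=d\}. \end{aligned}\] Proposition. There is an absolute constant $C>0$ such that for every such prime $p$ for which the Conjecture for $p$ holds, for every $P\subseteq\mathbb{Z}_q^2$ and every unit $d\in\mathbb{Z}_q^*$, \[|Q_d'|\le C\left(\frac{|\Pi_d'|^2}{p^3}+p^5\,|\Pi_d'|\right).\] -/

import Mathlib

/-! Bisectors in the plane `R × R` over a commutative ring `R` (used with `R = ZMod (p ^ 3)`). -/

namespace BisectorPlane

variable {R : Type*} [CommRing R]

/-- The "norm" `‖v‖ = v₁² + v₂²`, with values in `R`. -/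
def nrm (v : R × R) : R := v.1 ^ 2 + v.2 ^ 2

/-- The perpendicular bisector `B(x, y)` of two points. -/
def bisector (x y : R × R) : Set (R × R) := {z | nrm (z - x) = nrm (z - y)}

/-- `L` is a non-isotropic line: the solution set of `a x + b y = c`
with `a`, `b` and `a² + b²` units. -/
def IsNonIsotropicLine (L : Set (R × R)) : Prop :=
  ∃ a b c : R, IsUnit a ∧ IsUnit b ∧ IsUnit (a ^ 2 + b ^ 2) ∧
    L = {z : R × R | a * z.1 + b * z.2 = c}

/-- The affine map `f` is a reflection: `f v = S (v - u) + u` for a point `u` and a matrix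
`S = (a, b; b, -a)` with `a² + b² = 1`. -/
def IsReflection (f : R × R → R × R) : Prop :=
  ∃ (a b : R) (u : R × R), a ^ 2 + b ^ 2 = 1 ∧
    ∀ v : R × R, f v =
      (a * (v - u).1 + b * (v - u).2, b * (v - u).1 - a * (v - u).2) + u

/-- A reflection in a non-isotropic line: its axis (the set of its fixed points) is a
non-isotropic line. -/
def IsNonIsotropicReflection (f : R × R → R × R) : Prop :=
  IsReflection f ∧ IsNonIsotropicLine {v | f v = v}

/-- `𝒩(x, y)`: the number of pairs `(f₁, f₂)` of reflections in non-isotropic lines with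
`yᵢ = f₂ (f₁ xᵢ)` for `i = 1, 2`. -/
noncomputable def reflectionPairCount (x y : (R × R) × (R × R)) : ℕ :=
  {f : (R × R → R × R) × (R × R → R × R) |
    IsNonIsotropicReflection f.1 ∧ IsNonIsotropicReflection f.2 ∧
      f.2 (f.1 x.1) = y.1 ∧ f.2 (f.1 x.2) = y.2}.ncard

/-- `𝒜ₓ(n)`: the number of point pairs `y` with `𝒩(x, y) = n`. -/
noncomputable def fiberCount (x : (R × R) × (R × R)) (n : ℕ) : ℕ :=
  {y : (R × R) × (R × R) | reflectionPairCount x y = n}.ncard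

/-- The conjectured distribution of the positive values of `𝒩(x, ·)` over `ℤ / p³`, for all
point pairs `x` at unit distance. No subtraction is truncated when `p ≥ 3`; the first value
`p³ - 3p²` is positive unless `p = 3`, where it is `0`. -/
def KeyConjecture (p : ℕ) : Prop :=
  ∀ x : (ZMod (p ^ 3) × ZMod (p ^ 3)) × (ZMod (p ^ 3) × ZMod (p ^ 3)),
    IsUnit (nrm (x.1 - x.2)) →
      (0 < p ^ 3 - 3 * p ^ 2 → fiberCount x (p ^ 3 - 3 * p ^ 2) = p ^ 9 - p ^ 8) ∧
      fiberCount x (p ^ 3 - p ^ 2) = p ^ 8 ∧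
      fiberCount x (p ^ 3) = p ^ 8 - 2 * p ^ 7 + p ^ 6 ∧
      fiberCount x (p ^ 4 - p ^ 3) = p ^ 6 - p ^ 5 ∧
      fiberCount x (p ^ 4) = p ^ 5 - 2 * p ^ 4 + p ^ 3 ∧
      fiberCount x (p ^ 5 - p ^ 4) = p ^ 3 - p ^ 2 ∧
      fiberCount x (p ^ 5) = p ^ 2 - 2 * p + 1 ∧
      fiberCount x (p ^ 6 - p ^ 5) = 1 ∧
      ∀ n : ℕ, 0 < n →
        n ∉ ({p ^ 3 - 3 * p ^ 2, p ^ 3 - p ^ 2, p ^ 3, p ^ 4 - p ^ 3, p ^ 4,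
          p ^ 5 - p ^ 4, p ^ 5, p ^ 6 - p ^ 5} : Set ℕ) →
        fiberCount x n = 0

/-- `P̃`: the pairs of points of `P` whose difference has two unit coordinates. -/
def tildePairs (P : Set (R × R)) : Set ((R × R) × (R × R)) :=
  {t | t.1 ∈ P ∧ t.2 ∈ P ∧ IsUnit (t.1 - t.2).1 ∧ IsUnit (t.1 - t.2).2}

/-- `Q'`: the quadruples `((x, y), (z, w))` of `P̃ × P̃` such that `B(x, z) = B(y, w)` is
non-isotropic. -/
def QPrime (P : Set (R × R)) : Set (((R × R) × (R × R)) × ((R × R) × (R × R))) :=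
  {s | s.1 ∈ tildePairs P ∧ s.2 ∈ tildePairs P ∧
    bisector s.1.1 s.2.1 = bisector s.1.2 s.2.2 ∧
    IsNonIsotropicLine (bisector s.1.1 s.2.1)}

/-- `Q_d'`: the quadruples `((x, y), (z, w))` of `Q'` with `‖x - y‖ = ‖z - w‖ = d`. -/
def QPrimeAt (P : Set (R × R)) (d : R) :
    Set (((R × R) × (R × R)) × ((R × R) × (R × R))) :=
  {s | s ∈ QPrime P ∧ nrm (s.1.1 - s.1.2) = d ∧ nrm (s.2.1 - s.2.2) = d}

/-- `Π_d'`: the pairs `(x, y)` of `P̃` with `‖x - y‖ = d`. -/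
def PiPrimeAt (P : Set (R × R)) (d : R) : Set ((R × R) × (R × R)) :=
  {t | t ∈ tildePairs P ∧ nrm (t.1 - t.2) = d}

end BisectorPlane

/-! This is a second-moment argument. Let `F` be the non-isotropic reflections, `X` the pairs at
distance `d`, `T` = `Π_d'`, and `g s` the number of `f ∈ F` sending the pair `s` into `T`. If `B(x,
z) = B(y, w)` is a non-isotropic line, then reflection in it carries `(x, y)` to `(z, w)`, so
`|Q_d'| ≤ ∑_{s ∈ T} g s`.

Reflections are involutive isometries, so `∑_X g = #F * #T`, and `∑_X g²` is the sum of `𝒩(t, t')`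
over `t, t' ∈ T`. By the conjecture `𝒩(t, ·)` is at most `p³ - 3p²`, up to an excess whose total
over all `t'` is at most `10p¹⁰`. With `#F ≥ p⁶ - p⁵` and `#X ≤ p⁹ + p⁸` the main terms cancel to
the two leading orders in `p`, so the deviation of `g` from its expected value has square sum `O(p¹⁰
#T)`. Cauchy–Schwarz on `T` gives the bound. -/

/-! ### Double counting and the second moment -/

open Finset in
/-- Double counting for involutions: the number of `(i, s)` with `act i s ∈ T`. -/
theorem sum_card_involutive_hits {ι Y : Type*} [DecidableEq Y] (F : Finset ι) (act : ι → Y → Y)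
    (X T : Finset Y) (hinv : ∀ i ∈ F, Function.Involutive (act i)) (hTX : T ⊆ X)
    (hX : ∀ i ∈ F, ∀ s ∈ X, act i s ∈ X) :
    ∑ s ∈ X, #{i ∈ F | act i s ∈ T} = #F * #T := by
  simp_rw [card_filter]
  rw [sum_comm, ← smul_eq_mul, ← sum_const]
  refine sum_congr rfl fun i hi => ?_
  rw [← card_filter]
  refine card_bij (fun s _ => act i s) ?_ ?_ ?_
  · simp
  · intro a _ b _ h
    exact (hinv i hi).injective h
  · intro t ht
    exact ⟨act i t, by simp [hinv i hi t, ht, hX i hi t (hTX ht)], hinv i hi t⟩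

open Finset in
/-- The second moment of the number of hits of `T` counts two-step paths inside `T`. -/
theorem sum_sq_card_involutive_hits {ι Y : Type*} [DecidableEq Y] (F : Finset ι)
    (act : ι → Y → Y) (X T : Finset Y) (hinv : ∀ i ∈ F, Function.Involutive (act i))
    (hTX : T ⊆ X) (hX : ∀ i ∈ F, ∀ s ∈ X, act i s ∈ X) :
    ∑ s ∈ X, #{i ∈ F | act i s ∈ T} ^ 2 =
      ∑ t ∈ T, ∑ t' ∈ T, #{f ∈ F ×ˢ F | act f.2 (act f.1 t) = t'} := by
  have hL : ∀ s, #{i ∈ F | act i s ∈ T} ^ 2 =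
      ∑ f ∈ F ×ˢ F, if act f.1 s ∈ T ∧ act f.2 s ∈ T then 1 else 0 := by
    intro s
    rw [sq, ← card_product, ← card_filter, ← filter_product]
  have hR : ∀ t, ∑ t' ∈ T, #{f ∈ F ×ˢ F | act f.2 (act f.1 t) = t'} =
      ∑ f ∈ F ×ˢ F, if act f.2 (act f.1 t) ∈ T then 1 else 0 := by
    intro t
    simp_rw [card_filter]
    rw [sum_comm]
    refine sum_congr rfl fun f _ => ?_
    rw [sum_ite_eq]
  simp_rw [hL, hR]
  rw [sum_comm, sum_comm (s := T)]
  refine sum_congr rfl fun f hf => ?_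
  rw [mem_product] at hf
  rw [← card_filter, ← card_filter]
  -- Substitute `t = f.1 s`: since `s = f.1 t`, the two hits `f.1 s, f.2 s ∈ T` become `t ∈ T` and
  -- `f.2 (f.1 t) ∈ T`.
  refine card_bij (fun s _ => act f.1 s) ?_ ?_ ?_
  · intro s hs
    simp only [mem_filter] at hs ⊢
    rw [hinv _ hf.1 s]
    exact hs.2
  · intro a _ b _ h
    exact (hinv _ hf.1).injective h
  · intro t ht
    simp only [mem_filter] at ht
    exact ⟨act f.1 t, by simp [hinv _ hf.1 t, ht, hX _ hf.1 t (hTX ht.1)], hinv _ hf.1 t⟩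

open Finset in
/-- A second-moment bound: a function `g` on `X` with large mean and small second moment has
sum over `T` at most the expected `D / M * #T ^ 2`, up to the error `E * #T`. -/
theorem sum_le_of_second_moment {Y : Type*} (X T : Finset Y) (g : Y → ℝ) (hTX : T ⊆ X)
    {D M β E : ℝ} (hD : 0 ≤ D) (hM : 0 < M) (hX : (#X : ℝ) ≤ M)
    (h1 : D * #T ≤ ∑ s ∈ X, g s) (h2 : ∑ s ∈ X, g s ^ 2 ≤ β * #T ^ 2 + E ^ 2 * #T)
    (hβ : β * M ≤ D ^ 2) (hE : 0 ≤ E) :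
    ∑ s ∈ T, g s ≤ D / M * #T ^ 2 + E * #T := by
  set n : ℝ := (#T : ℝ)
  have hn0 : 0 ≤ n := Nat.cast_nonneg _
  set α : ℝ := D / M * n with hα
  have hα0 : 0 ≤ α := by positivity
  -- Expanding the square, the terms in `α` contribute at most `-D²n²/M`, which absorbs `βn²` by
  -- `hβ`; only the error term survives.
  have hvar : ∑ s ∈ X, (g s - α) ^ 2 ≤ E ^ 2 * n := by
    have e : ∑ s ∈ X, (g s - α) ^ 2 =
        ∑ s ∈ X, g s ^ 2 - 2 * α * ∑ s ∈ X, g s + #X * α ^ 2 := by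
      rw [mul_sum, ← nsmul_eq_mul, ← sum_const, ← sum_sub_distrib, ← sum_add_distrib]
      exact sum_congr rfl fun _ _ => by ring
    have h3 : 2 * α * (D * n) ≤ 2 * α * ∑ s ∈ X, g s :=
      mul_le_mul_of_nonneg_left h1 (by positivity)
    have h4 : (#X : ℝ) * α ^ 2 ≤ M * α ^ 2 := mul_le_mul_of_nonneg_right hX (by positivity)
    have h5 : 2 * α * (D * n) - M * α ^ 2 = D ^ 2 / M * n ^ 2 := by
      rw [hα]; field_simp; ring
    have h6 : β * n ^ 2 ≤ D ^ 2 / M * n ^ 2 :=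
      mul_le_mul_of_nonneg_right ((le_div_iff₀ hM).2 hβ) (by positivity)
    linarith
  have hcs : (∑ s ∈ T, (g s - α)) ^ 2 ≤ n * ∑ s ∈ T, (g s - α) ^ 2 :=
    sq_sum_le_card_mul_sum_sq
  have hsub : ∑ s ∈ T, (g s - α) ^ 2 ≤ ∑ s ∈ X, (g s - α) ^ 2 :=
    sum_le_sum_of_subset_of_nonneg hTX fun _ _ _ => sq_nonneg _
  have hsq : (∑ s ∈ T, (g s - α)) ^ 2 ≤ (E * n) ^ 2 := by
    calc _ ≤ n * (E ^ 2 * n) := hcs.trans (mul_le_mul_of_nonneg_left (hsub.trans hvar) hn0)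
      _ = _ := by ring
  have h7 := abs_le_of_sq_le_sq' hsq (by positivity)
  have h8 : ∑ s ∈ T, (g s - α) = ∑ s ∈ T, g s - n * α := by
    rw [sum_sub_distrib, sum_const, nsmul_eq_mul]
  have h9 : n * α = D / M * n ^ 2 := by rw [hα]; ring
  linarith [h7.2]

/-! ### Reflections and bisectors over a commutative ring -/

namespace BisectorPlane

section Reflections

variable {R : Type*} [CommRing R]

theorem IsReflection.involutive {f : R × R → R × R} (hf : IsReflection f) :
    Function.Involutive f := by
  obtain ⟨a, b, u, h, hf⟩ := hf
  intro v
  rw [hf (f v), hf v]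
  ext
  · simp only [Prod.fst_add, Prod.snd_add, Prod.fst_sub, Prod.snd_sub]
    linear_combination (v.1 - u.1) * h
  · simp only [Prod.fst_add, Prod.snd_add, Prod.fst_sub, Prod.snd_sub]
    linear_combination (v.2 - u.2) * h

theorem IsReflection.nrm_sub {f : R × R → R × R} (hf : IsReflection f) (v w : R × R) :
    nrm (f v - f w) = nrm (v - w) := by
  obtain ⟨a, b, u, h, hf⟩ := hf
  rw [hf v, hf w]
  simp only [nrm, Prod.fst_add, Prod.snd_add, Prod.fst_sub, Prod.snd_sub]
  linear_combination ((v.1 - w.1) ^ 2 + (v.2 - w.2) ^ 2) * h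

/-- The reflection in the line `v₁ + b v₂ = c`, where `e` is the inverse of `1 + b²`. -/
def lineReflection (e b c : R) (v : R × R) : R × R :=
  (v.1 - 2 * e * (v.1 + b * v.2 - c), v.2 - 2 * e * b * (v.1 + b * v.2 - c))

theorem isReflection_lineReflection {e b : R} (he : (1 + b ^ 2) * e = 1) (c : R) :
    IsReflection (lineReflection e b c) := by
  -- The matrix is `I - 2e nnᵀ` with normal `n = (1, b)`; its last entry `1 - 2eb²` equals `-(1 -
  -- 2e)` by `he`. The point `(c, 0)` lies on the axis.
  refine ⟨1 - 2 * e, -2 * e * b, (c, 0), ?_, fun v => ?_⟩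
  · linear_combination 4 * e * he
  · ext
    · simp only [lineReflection, Prod.fst_add, Prod.fst_sub, Prod.snd_sub]
      ring
    · simp only [lineReflection, Prod.snd_add, Prod.fst_sub, Prod.snd_sub]
      linear_combination (-2) * v.2 * he

theorem lineReflection_eq_self_iff (h2 : IsUnit (2 : R)) {e b : R} (he : (1 + b ^ 2) * e = 1)
    (c : R) (v : R × R) : lineReflection e b c v = v ↔ v.1 + b * v.2 = c := by
  constructor
  · intro h
    have h1 := congrArg Prod.fst h
    simp only [lineReflection] at h1
    refine sub_eq_zero.1 (h2.mul_right_eq_zero.1 ?_)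
    linear_combination (-(1 + b ^ 2)) * h1 - 2 * (v.1 + b * v.2 - c) * he
  · intro h
    ext <;> simp [lineReflection, h]

theorem isNonIsotropicReflection_lineReflection (h2 : IsUnit (2 : R)) {e b : R} (hb : IsUnit b)
    (he : (1 + b ^ 2) * e = 1) (c : R) :
    IsNonIsotropicReflection (lineReflection e b c) := by
  refine ⟨isReflection_lineReflection he c, 1, b, c, isUnit_one, hb, ?_, ?_⟩
  · rw [one_pow]
    exact IsUnit.of_mul_eq_one _ he
  · ext v
    simp only [Set.mem_ofPred_eq, one_mul]
    exact lineReflection_eq_self_iff h2 he c v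

theorem lineReflection_injective (h2 : IsUnit (2 : R)) {e b e' b' c c' : R}
    (he : (1 + b ^ 2) * e = 1) (he' : (1 + b' ^ 2) * e' = 1)
    (h : lineReflection e b c = lineReflection e' b' c') : b = b' ∧ c = c' := by
  have key : ∀ v : R × R, v.1 + b * v.2 = c → v.1 + b' * v.2 = c' := fun v hv =>
    (lineReflection_eq_self_iff h2 he' c' v).1 (h ▸ (lineReflection_eq_self_iff h2 he c v).2 hv)
  have h0 := key (c, 0) (by simp)
  have h1 := key (c - b, 1) (by simp)
  simp only [mul_zero, add_zero, mul_one] at h0 h1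
  exact ⟨by linear_combination h0 - h1, h0⟩

/-- If some nonzero element is killed by all nonunits, then a non-isotropic bisector
`B(x, z)` with equation `a v₁ + b v₂ = c` is the axis of a reflection taking `x` to `z`. -/
theorem lineReflection_eq_of_bisector_eq {π : R} (hπ : π ≠ 0)
    (hπ' : ∀ r : R, ¬ IsUnit r → r * π = 0) (h2 : IsUnit (2 : R)) {e b c : R}
    (he : (1 + b ^ 2) * e = 1) {x z : R × R}
    (h : bisector x z = {v | v.1 + b * v.2 = c}) : lineReflection e b c x = z := by
  obtain ⟨x₁, x₂⟩ := x
  obtain ⟨z₁, z₂⟩ := z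
  have key : ∀ s t : R, 2 * (s * (z₁ - x₁) + t * (z₂ - x₂)) = z₁ ^ 2 + z₂ ^ 2 - x₁ ^ 2 - x₂ ^ 2 ↔
      s + b * t = c := by
    intro s t
    have := Set.ext_iff.1 h (s, t)
    simp only [bisector, nrm, Set.mem_ofPred_eq, Prod.fst_sub, Prod.snd_sub] at this
    rw [← this]
    constructor <;> intro h <;> linear_combination h
  -- The points `(c, 0)` and `(c - b, 1)` of the line give, by difference, that `z - x` is parallel
  -- to the normal `(1, b)`.
  have h0 := (key c 0).2 (by ring)
  have h1 := (key (c - b) 1).2 (by ring)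
  have hdir : z₂ - x₂ = b * (z₁ - x₁) := by
    refine sub_eq_zero.1 (h2.mul_right_eq_zero.1 ?_)
    linear_combination h1 - h0
  -- Otherwise `π` kills `z₁ - x₁`, and the bisector is stable under translation by `(π, 0)`,
  -- whereas `v₁ + b v₂` changes by `π ≠ 0`.
  have hu : IsUnit (z₁ - x₁) := by
    by_contra hu
    have h3 := (key (c + π) 0).1 (by linear_combination h0 + 2 * hπ' _ hu)
    exact hπ (by linear_combination h3)
  -- The midpoint of `x` and `z` is on the line, after cancelling the unit `z₁ - x₁`.
  have hmid : 2 * c = z₁ + x₁ + b * (z₂ + x₂) := by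
    refine sub_eq_zero.1 (hu.mul_right_eq_zero.1 ?_)
    linear_combination h0 + (z₂ + x₂) * hdir
  ext
  · simp only [lineReflection]
    linear_combination e * hmid + e * b * hdir + (z₁ - x₁) * he
  · simp only [lineReflection]
    linear_combination e * b * hmid + (e * b ^ 2 - 1) * hdir + b * (z₁ - x₁) * he

/-- Dividing the line's equation by the unit `a` gives the form `v₁ + b v₂ = c`; the common bisector
then determines one reflection serving both pairs. -/
theorem exists_reflection_of_bisector_eq {π : R} (hπ : π ≠ 0)
    (hπ' : ∀ r : R, ¬ IsUnit r → r * π = 0) (h2 : IsUnit (2 : R)) {x y z w : R × R}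
    (h : bisector x z = bisector y w) (hL : IsNonIsotropicLine (bisector x z)) :
    ∃ f, IsNonIsotropicReflection f ∧ f x = z ∧ f y = w := by
  obtain ⟨a, b, c, ⟨a, rfl⟩, hb, hab, hL⟩ := hL
  have hL' : bisector x z = {v | v.1 + (↑a⁻¹ * b) * v.2 = ↑a⁻¹ * c} := by
    rw [hL]
    ext v
    simp only [Set.mem_ofPred_eq]
    constructor
    · intro h
      linear_combination (↑a⁻¹ : R) * h - v.1 * a.inv_mul
    · intro h
      linear_combination (a : R) * h + (c - b * v.2) * a.mul_inv
  have hu : IsUnit (1 + (↑a⁻¹ * b) ^ 2) := by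
    have : 1 + (↑a⁻¹ * b) ^ 2 = (↑a⁻¹ : R) ^ 2 * ((a : R) ^ 2 + b ^ 2) := by
      linear_combination (-(↑a⁻¹ * (a : R)) - 1) * a.inv_mul
    rw [this]
    exact ((a⁻¹).isUnit.pow 2).mul hab
  obtain ⟨e, he⟩ := hu.exists_right_inv
  exact ⟨lineReflection e (↑a⁻¹ * b) (↑a⁻¹ * c),
    isNonIsotropicReflection_lineReflection h2 ((a⁻¹).isUnit.mul hb) he _,
    lineReflection_eq_of_bisector_eq hπ hπ' h2 he hL',
    lineReflection_eq_of_bisector_eq hπ hπ' h2 he (h ▸ hL')⟩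

end Reflections

end BisectorPlane

/-! ### Units, circles and reflections over `ℤ / p³` -/

namespace BisectorPlane

section PrimeCube

variable {p : ℕ}

theorem isUnit_iff_castHom_ne_zero [Fact p.Prime] (x : ZMod (p ^ 3)) :
    IsUnit x ↔ ZMod.castHom (dvd_pow_self p three_ne_zero) (ZMod p) x ≠ 0 := by
  have : NeZero (p ^ 3) := ⟨pow_ne_zero 3 (Fact.out : p.Prime).ne_zero⟩
  obtain ⟨n, rfl⟩ := ZMod.natCast_zmod_surjective x
  rw [map_natCast, Ne, ZMod.natCast_eq_zero_iff, ZMod.isUnit_iff_coprime,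
    Nat.coprime_pow_right_iff (by norm_num), Nat.coprime_comm,
    (Fact.out : p.Prime).coprime_iff_not_dvd]

theorem mul_prime_sq_eq_zero [Fact p.Prime] {x : ZMod (p ^ 3)} (hx : ¬ IsUnit x) :
    x * (p : ZMod (p ^ 3)) ^ 2 = 0 := by
  have : NeZero (p ^ 3) := ⟨pow_ne_zero 3 (Fact.out : p.Prime).ne_zero⟩
  rw [isUnit_iff_castHom_ne_zero, not_not] at hx
  obtain ⟨n, rfl⟩ := ZMod.natCast_zmod_surjective x
  rw [map_natCast, ZMod.natCast_eq_zero_iff] at hx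
  obtain ⟨k, rfl⟩ := hx
  have h0 : ((p ^ 3 : ℕ) : ZMod (p ^ 3)) = 0 := ZMod.natCast_self _
  push_cast at h0 ⊢
  linear_combination (k : ZMod (p ^ 3)) * h0

theorem prime_sq_ne_zero [Fact p.Prime] : (p : ZMod (p ^ 3)) ^ 2 ≠ 0 := by
  have hp := (Fact.out : p.Prime).one_lt
  rw [← Nat.cast_pow, Ne, ZMod.natCast_eq_zero_iff]
  intro h
  exact absurd (Nat.pow_dvd_pow_iff_le_right hp |>.1 h) (by norm_num)

theorem isUnit_two [Fact p.Prime] (hp : p % 4 = 3) : IsUnit (2 : ZMod (p ^ 3)) := by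
  have h : ((2 : ℕ) : ZMod (p ^ 3)) = 2 := by norm_num
  rw [← h, ZMod.isUnit_prime_iff_not_dvd Nat.prime_two]
  intro h2
  have := Nat.prime_two.dvd_of_dvd_pow h2
  omega

/-- Modulo a prime `p ≡ 3 (mod 4)`, `-1` is not a square. -/
theorem isUnit_one_add_sq [Fact p.Prime] (hp : p % 4 = 3) (b : ZMod (p ^ 3)) :
    IsUnit (1 + b ^ 2) := by
  rw [isUnit_iff_castHom_ne_zero, map_add, map_one, map_pow]
  intro h
  exact ZMod.mod_four_ne_three_of_sq_eq_neg_one (eq_neg_of_add_eq_zero_right h) hp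

theorem ncard_isUnit [Fact p.Prime] : {x : ZMod (p ^ 3) | IsUnit x}.ncard = p ^ 3 - p ^ 2 := by
  have hp := (Fact.out : p.Prime)
  have : NeZero (p ^ 3) := ⟨pow_ne_zero 3 hp.ne_zero⟩
  have h : {x : ZMod (p ^ 3) | IsUnit x} = Set.range (Units.val : (ZMod (p ^ 3))ˣ → _) := rfl
  rw [h, ← Set.image_univ, Set.ncard_image_of_injective _ Units.val_injective, Set.ncard_univ,
    Nat.card_eq_fintype_card, ZMod.card_units_eq_totient, Nat.totient_prime_pow hp (by norm_num),
    Nat.mul_sub, mul_one]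
  rfl

theorem ncard_not_isUnit [Fact p.Prime] : {x : ZMod (p ^ 3) | ¬ IsUnit x}.ncard = p ^ 2 := by
  have hp := (Fact.out : p.Prime)
  have : NeZero (p ^ 3) := ⟨pow_ne_zero 3 hp.ne_zero⟩
  have h := Set.ncard_add_ncard_compl {x : ZMod (p ^ 3) | IsUnit x}
  rw [ncard_isUnit, Nat.card_eq_fintype_card, ZMod.card] at h
  have h2 : p ^ 2 ≤ p ^ 3 := Nat.pow_le_pow_right hp.pos (by norm_num)
  have e : {x : ZMod (p ^ 3) | ¬ IsUnit x} = {x : ZMod (p ^ 3) | IsUnit x}ᶜ := rfl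
  rw [e]
  omega

/-- Rational parametrization of the circle from `(-1, 0)`: the slope `m = b / (1 + a)` satisfies `(1
+ m²)(1 + a) = 2`, so it determines the point. -/
theorem eq_of_unit_circle_slope_eq {R : Type*} [CommRing R] (h2 : IsUnit (2 : R))
    {a b a' b' : R} (u u' : Rˣ) (hu : (u : R) = 1 + a) (hu' : (u' : R) = 1 + a')
    (h : a ^ 2 + b ^ 2 = 1) (h' : a' ^ 2 + b' ^ 2 = 1) (hs : b * ↑u⁻¹ = b' * ↑u'⁻¹) :
    a = a' ∧ b = b' := by
  have hb : b * u' = b' * u := by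
    linear_combination (u : R) * u' * hs - b * u' * u.mul_inv + b' * u * u'.mul_inv
  have hmul : (u : R) * u' * (2 * (a - a')) = 0 := by
    rw [hu, hu'] at hb ⊢
    linear_combination (1 + a') ^ 2 * h - (1 + a) ^ 2 * h' -
      (b * (1 + a') + b' * (1 + a)) * hb
  have ha : a = a' :=
    sub_eq_zero.1 (h2.mul_right_eq_zero.1 ((u.isUnit.mul u'.isUnit).mul_right_eq_zero.1 hmul))
  refine ⟨ha, ?_⟩
  have : u = u' := Units.ext (by rw [hu, hu', ha])
  subst this
  exact u.isUnit.mul_left_inj.1 hb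

/-- The unit circle of `ℤ / p³` has at most `p³ + p²` points: use the slope `b / (1 + a)`, or
the nonunit slope `b / (1 - a)` where the former is not defined. -/
theorem ncard_unit_circle_le [Fact p.Prime] (hp : p % 4 = 3) :
    {v : ZMod (p ^ 3) × ZMod (p ^ 3) | nrm v = 1}.ncard ≤ p ^ 3 + p ^ 2 := by
  have : NeZero (p ^ 3) := ⟨pow_ne_zero 3 (Fact.out : p.Prime).ne_zero⟩
  have h2 := isUnit_two hp
  set S : Set (ZMod (p ^ 3) × ZMod (p ^ 3)) := {v | nrm v = 1 ∧ IsUnit (1 + v.1)}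
  set S' : Set (ZMod (p ^ 3) × ZMod (p ^ 3)) := {v | nrm v = 1 ∧ ¬ IsUnit (1 + v.1)}
  have hunion : {v : ZMod (p ^ 3) × ZMod (p ^ 3) | nrm v = 1} = S ∪ S' := by
    ext v
    by_cases h : IsUnit (1 + v.1) <;> simp [S, S', h]
  have hS : S.ncard ≤ p ^ 3 := by
    have := Set.ncard_le_ncard_of_injOn (s := S) (t := Set.univ)
      (fun v => v.2 * Ring.inverse (1 + v.1)) (fun _ _ => Set.mem_univ _) (by
        rintro ⟨a, b⟩ ⟨hn, u, hu⟩ ⟨a', b'⟩ ⟨hn', u', hu'⟩ hs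
        simp only at hu hu' hs
        rw [← hu, ← hu', Ring.inverse_unit, Ring.inverse_unit] at hs
        obtain ⟨h1, h3⟩ := eq_of_unit_circle_slope_eq h2 u u' hu hu' hn hn' hs
        exact Prod.ext h1 h3) (Set.toFinite _)
    rwa [Set.ncard_univ, Nat.card_eq_fintype_card, ZMod.card] at this
  -- `1 + a` and `1 - a` sum to the unit `2`, so they cannot both vanish mod `p`.
  have hunit : ∀ a : ZMod (p ^ 3), ¬ IsUnit (1 + a) → IsUnit (1 - a) := by
    intro a ha
    rw [isUnit_iff_castHom_ne_zero] at ha h2 ⊢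
    rw [not_not] at ha
    intro h
    apply h2
    rw [show (2 : ZMod (p ^ 3)) = (1 + a) + (1 - a) by ring, map_add, ha, h, add_zero]
  have hS' : S'.ncard ≤ p ^ 2 := by
    rw [← ncard_not_isUnit (p := p)]
    refine Set.ncard_le_ncard_of_injOn (fun v => v.2 * Ring.inverse (1 - v.1)) ?_ ?_
      (Set.toFinite _)
    · rintro ⟨a, b⟩ ⟨hn, ha⟩ hu
      have hb : IsUnit (b ^ 2) := (isUnit_of_mul_isUnit_left hu).pow 2
      have : b ^ 2 = (1 + a) * (1 - a) := by
        simp only [nrm] at hn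
        linear_combination hn
      exact ha (isUnit_of_mul_isUnit_left (this ▸ hb))
    · rintro ⟨a, b⟩ ⟨hn, ha⟩ ⟨a', b'⟩ ⟨hn', ha'⟩ hs
      obtain ⟨u, hu⟩ := hunit a ha
      obtain ⟨u', hu'⟩ := hunit a' ha'
      simp only at hs
      rw [← hu, ← hu', Ring.inverse_unit, Ring.inverse_unit] at hs
      simp only [nrm] at hn hn'
      obtain ⟨h1, h3⟩ := eq_of_unit_circle_slope_eq h2 u u' (a := -a) (a' := -a')
        (by rw [hu]; ring) (by rw [hu']; ring) (by rw [← hn]; ring) (by rw [← hn']; ring) hs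
      rw [neg_inj.1 h1, h3]
  rw [hunion]
  exact (Set.ncard_union_le _ _).trans (add_le_add hS hS')

/-- Reading `v` as `v₁ + i v₂`, multiplication by `w̄ / d` for a fixed point `w` of the circle
injects it into the unit circle. -/
theorem ncard_circle_le [Fact p.Prime] (hp : p % 4 = 3) {d : ZMod (p ^ 3)} (hd : IsUnit d) :
    {v : ZMod (p ^ 3) × ZMod (p ^ 3) | nrm v = d}.ncard ≤ p ^ 3 + p ^ 2 := by
  have : NeZero (p ^ 3) := ⟨pow_ne_zero 3 (Fact.out : p.Prime).ne_zero⟩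
  obtain ⟨u, rfl⟩ := hd
  rcases Set.eq_empty_or_nonempty {v : ZMod (p ^ 3) × ZMod (p ^ 3) | nrm v = u} with h | ⟨w, hw⟩
  · rw [h]; simp
  refine le_trans ?_ (ncard_unit_circle_le hp)
  simp only [nrm, Set.mem_ofPred_eq] at hw
  refine Set.ncard_le_ncard_of_injOn
    (fun v => (↑u⁻¹ * (v.1 * w.1 + v.2 * w.2), ↑u⁻¹ * (v.2 * w.1 - v.1 * w.2))) ?_ ?_
    (Set.toFinite _)
  · rintro ⟨a, b⟩ hv
    simp only [nrm, Set.mem_ofPred_eq] at hv ⊢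
    linear_combination (↑u⁻¹ : ZMod (p ^ 3)) ^ 2 * (w.1 ^ 2 + w.2 ^ 2) * hv +
      (↑u⁻¹ : ZMod (p ^ 3)) ^ 2 * u * hw + (↑u⁻¹ * (u : ZMod (p ^ 3)) + 1) * u.inv_mul
  · rintro ⟨a, b⟩ - ⟨a', b'⟩ - h
    simp only [Prod.mk.injEq, (u⁻¹).isUnit.mul_right_inj] at h
    obtain ⟨h1, h3⟩ := h
    ext
    · refine u.isUnit.mul_right_inj.1 ?_
      simp only
      linear_combination (a' - a) * hw + w.1 * h1 - w.2 * h3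
    · refine u.isUnit.mul_right_inj.1 ?_
      simp only
      linear_combination (b' - b) * hw + w.2 * h1 + w.1 * h3

theorem ncard_pairs_at_le [Fact p.Prime] (hp : p % 4 = 3) {d : ZMod (p ^ 3)} (hd : IsUnit d) :
    {t : (ZMod (p ^ 3) × ZMod (p ^ 3)) × (ZMod (p ^ 3) × ZMod (p ^ 3)) |
      nrm (t.1 - t.2) = d}.ncard ≤ p ^ 9 + p ^ 8 := by
  have : NeZero (p ^ 3) := ⟨pow_ne_zero 3 (Fact.out : p.Prime).ne_zero⟩
  have h := Set.ncard_le_ncard_of_injOn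
    (s := {t : (ZMod (p ^ 3) × ZMod (p ^ 3)) × (ZMod (p ^ 3) × ZMod (p ^ 3)) |
      nrm (t.1 - t.2) = d})
    (t := (Set.univ : Set (ZMod (p ^ 3) × ZMod (p ^ 3))) ×ˢ
      {v : ZMod (p ^ 3) × ZMod (p ^ 3) | nrm v = d})
    (fun t => (t.1, t.1 - t.2)) (fun t ht => ⟨Set.mem_univ _, ht⟩) (by
      rintro ⟨x, y⟩ - ⟨x', y'⟩ - h
      simp only [Prod.mk.injEq] at h
      obtain ⟨rfl, h⟩ := h
      rw [sub_right_inj.1 h]) (Set.toFinite _)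
  rw [Set.ncard_prod, Set.ncard_univ, Nat.card_eq_fintype_card, Fintype.card_prod,
    ZMod.card] at h
  calc _ ≤ _ := h
    _ ≤ p ^ 3 * p ^ 3 * (p ^ 3 + p ^ 2) := Nat.mul_le_mul_left _ (ncard_circle_le hp hd)
    _ = _ := by ring

/-- Lines `v₁ + b v₂ = c` with `b` a unit are automatically non-isotropic, and distinct `(c, b)`
give distinct axes. -/
theorem le_ncard_isNonIsotropicReflection [Fact p.Prime] (hp : p % 4 = 3) :
    p ^ 3 * (p ^ 3 - p ^ 2) ≤
      {f : ZMod (p ^ 3) × ZMod (p ^ 3) → ZMod (p ^ 3) × ZMod (p ^ 3) |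
        IsNonIsotropicReflection f}.ncard := by
  have : NeZero (p ^ 3) := ⟨pow_ne_zero 3 (Fact.out : p.Prime).ne_zero⟩
  have h2 := isUnit_two hp
  have h := Set.ncard_le_ncard_of_injOn
    (s := (Set.univ : Set (ZMod (p ^ 3))) ×ˢ {b : ZMod (p ^ 3) | IsUnit b})
    (t := {f : ZMod (p ^ 3) × ZMod (p ^ 3) → ZMod (p ^ 3) × ZMod (p ^ 3) |
        IsNonIsotropicReflection f})
    (fun q => lineReflection (Ring.inverse (1 + q.2 ^ 2)) q.2 q.1)
    (fun q hq => isNonIsotropicReflection_lineReflection h2 hq.2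
      (Ring.mul_inverse_cancel _ (isUnit_one_add_sq hp _)) _) (by
      rintro ⟨c, b⟩ - ⟨c', b'⟩ - h
      obtain ⟨h1, h3⟩ := lineReflection_injective h2
        (Ring.mul_inverse_cancel _ (isUnit_one_add_sq hp _))
        (Ring.mul_inverse_cancel _ (isUnit_one_add_sq hp _)) h
      simp only at h1 h3
      rw [h1, h3]) (Set.toFinite _)
  rwa [Set.ncard_prod, ncard_isUnit, Set.ncard_univ, Nat.card_eq_fintype_card, ZMod.card] at h

end PrimeCube

end BisectorPlane

/-! ### Using the conjecture and assembling the bound -/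

namespace BisectorPlane

section Main

variable {p : ℕ}

open Finset in
theorem sum_ite_reflectionPairCount_le [NeZero (p ^ 3)]
    (x : (ZMod (p ^ 3) × ZMod (p ^ 3)) × (ZMod (p ^ 3) × ZMod (p ^ 3)))
    (T : Finset ((ZMod (p ^ 3) × ZMod (p ^ 3)) × (ZMod (p ^ 3) × ZMod (p ^ 3)))) (n : ℕ)
    {c A : ℝ} (hc : 0 ≤ c) (hA : (fiberCount x n : ℝ) ≤ A) :
    ∑ y ∈ T, (if reflectionPairCount x y = n then c else 0) ≤ A * c := by
  rw [← sum_filter, sum_const, nsmul_eq_mul]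
  refine mul_le_mul_of_nonneg_right (le_trans ?_ hA) hc
  rw [fiberCount, ← Set.ncard_coe_finset]
  have hsub : (↑{y ∈ T | reflectionPairCount x y = n} : Set _) ⊆
      {y | reflectionPairCount x y = n} := fun y hy => (mem_filter.1 (mem_coe.1 hy)).2
  exact_mod_cast Set.ncard_le_ncard hsub (Set.toFinite _)

/-- Each larger value is charged with its excess over the base value `p³ - 3p²`. The excesses `2p²`
and `3p²` are kept exact because their fibers have order `p⁸`; the rarer values are rounded up. -/
theorem reflectionPairCount_le [Fact p.Prime] (hp : 3 ≤ p) (hconj : KeyConjecture p)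
    {x : (ZMod (p ^ 3) × ZMod (p ^ 3)) × (ZMod (p ^ 3) × ZMod (p ^ 3))}
    (hx : IsUnit (nrm (x.1 - x.2)))
    (y : (ZMod (p ^ 3) × ZMod (p ^ 3)) × (ZMod (p ^ 3) × ZMod (p ^ 3))) :
    (reflectionPairCount x y : ℝ) ≤ ((p : ℝ) ^ 3 - 3 * (p : ℝ) ^ 2) +
      ((if reflectionPairCount x y = p ^ 3 - p ^ 2 then 2 * (p : ℝ) ^ 2 else 0) +
      (if reflectionPairCount x y = p ^ 3 then 3 * (p : ℝ) ^ 2 else 0) +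
      (if reflectionPairCount x y = p ^ 4 - p ^ 3 then (p : ℝ) ^ 4 else 0) +
      (if reflectionPairCount x y = p ^ 4 then (p : ℝ) ^ 4 else 0) +
      (if reflectionPairCount x y = p ^ 5 - p ^ 4 then (p : ℝ) ^ 5 else 0) +
      (if reflectionPairCount x y = p ^ 5 then (p : ℝ) ^ 5 else 0) +
      (if reflectionPairCount x y = p ^ 6 - p ^ 5 then (p : ℝ) ^ 6 else 0)) := by
  have : NeZero (p ^ 3) := ⟨pow_ne_zero 3 (Fact.out : p.Prime).ne_zero⟩
  obtain ⟨-, -, -, -, -, -, -, -, hzero⟩ := hconj x hx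
  have hp3 : (3 : ℝ) ≤ p := by exact_mod_cast hp
  have hβ : (0 : ℝ) ≤ (p : ℝ) ^ 3 - 3 * (p : ℝ) ^ 2 := by
    have : (0 : ℝ) ≤ (p : ℝ) ^ 2 * (p - 3) := mul_nonneg (by positivity) (by linarith)
    linarith
  set N := reflectionPairCount x y
  have hite : ∀ (n : ℕ) (c : ℝ), 0 ≤ c → 0 ≤ (if N = n then c else 0) := by
    intro n c hc
    split_ifs <;> simp [hc]
  have i1 := hite (p ^ 3 - p ^ 2) (2 * (p : ℝ) ^ 2) (by positivity)
  have i2 := hite (p ^ 3) (3 * (p : ℝ) ^ 2) (by positivity)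
  have i3 := hite (p ^ 4 - p ^ 3) ((p : ℝ) ^ 4) (by positivity)
  have i4 := hite (p ^ 4) ((p : ℝ) ^ 4) (by positivity)
  have i5 := hite (p ^ 5 - p ^ 4) ((p : ℝ) ^ 5) (by positivity)
  have i6 := hite (p ^ 5) ((p : ℝ) ^ 5) (by positivity)
  have i7 := hite (p ^ 6 - p ^ 5) ((p : ℝ) ^ 6) (by positivity)
  have hpow : ∀ k, p ^ k ≤ p ^ (k + 1) := fun k => Nat.pow_le_pow_right (by omega) (by omega)
  have c1 : ((p ^ 3 - p ^ 2 : ℕ) : ℝ) = (p : ℝ) ^ 3 - (p : ℝ) ^ 2 := by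
    rw [Nat.cast_sub (hpow 2)]; push_cast; ring
  have c0 : ((p ^ 3 - 3 * p ^ 2 : ℕ) : ℝ) = (p : ℝ) ^ 3 - 3 * (p : ℝ) ^ 2 := by
    rw [Nat.cast_sub (by rw [pow_succ' p 2]; exact Nat.mul_le_mul_right _ hp)]; push_cast; ring
  have csub : ∀ k, ((p ^ (k + 1) - p ^ k : ℕ) : ℝ) ≤ (p : ℝ) ^ (k + 1) := fun k => by
    exact_mod_cast Nat.sub_le _ _
  rcases Nat.eq_zero_or_pos N with h0 | hpos
  · rw [h0] at i1 i2 i3 i4 i5 i6 i7 ⊢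
    push_cast
    linarith
  by_cases hmem : N ∈ ({p ^ 3 - 3 * p ^ 2, p ^ 3 - p ^ 2, p ^ 3, p ^ 4 - p ^ 3, p ^ 4,
      p ^ 5 - p ^ 4, p ^ 5, p ^ 6 - p ^ 5} : Set ℕ)
  · simp only [Set.mem_insert_iff, Set.mem_singleton_iff] at hmem
    rcases hmem with h | h | h | h | h | h | h | h
    · have : (N : ℝ) = (p : ℝ) ^ 3 - 3 * (p : ℝ) ^ 2 := by rw [h, c0]
      linarith
    · have : (N : ℝ) = (p : ℝ) ^ 3 - (p : ℝ) ^ 2 := by rw [h, c1]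
      rw [if_pos h] at i1 ⊢
      linarith
    · have : (N : ℝ) = (p : ℝ) ^ 3 := by rw [h]; push_cast; rfl
      rw [if_pos h] at i2 ⊢
      linarith
    · have : (N : ℝ) ≤ (p : ℝ) ^ 4 := by rw [h]; exact csub 3
      rw [if_pos h] at i3 ⊢
      linarith
    · have : (N : ℝ) = (p : ℝ) ^ 4 := by rw [h]; push_cast; rfl
      rw [if_pos h] at i4 ⊢
      linarith
    · have : (N : ℝ) ≤ (p : ℝ) ^ 5 := by rw [h]; exact csub 4
      rw [if_pos h] at i5 ⊢
      linarith
    · have : (N : ℝ) = (p : ℝ) ^ 5 := by rw [h]; push_cast; rfl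
      rw [if_pos h] at i6 ⊢
      linarith
    · have : (N : ℝ) ≤ (p : ℝ) ^ 6 := by rw [h]; exact csub 5
      rw [if_pos h] at i7 ⊢
      linarith
  -- An unlisted positive value has an empty fiber, but `y` lies in it.
  · have h := hzero N hpos hmem
    rw [fiberCount, Set.ncard_eq_zero (Set.toFinite _)] at h
    exact absurd (show y ∈ {y | reflectionPairCount x y = N} from rfl) (h ▸ Set.notMem_empty y)

open Finset in
-- Weighting each excess by its fiber size gives `2p¹⁰ + 3p¹⁰ + p¹⁰ + p⁹ + p⁸ + p⁷ + p⁶`, ten terms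
-- each at most `p¹⁰`.
theorem sum_reflectionPairCount_le [Fact p.Prime] (hp : 3 ≤ p) (hconj : KeyConjecture p)
    {x : (ZMod (p ^ 3) × ZMod (p ^ 3)) × (ZMod (p ^ 3) × ZMod (p ^ 3))}
    (hx : IsUnit (nrm (x.1 - x.2)))
    (T : Finset ((ZMod (p ^ 3) × ZMod (p ^ 3)) × (ZMod (p ^ 3) × ZMod (p ^ 3)))) :
    ∑ y ∈ T, (reflectionPairCount x y : ℝ) ≤
      ((p : ℝ) ^ 3 - 3 * (p : ℝ) ^ 2) * #T + 10 * (p : ℝ) ^ 10 := by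
  have : NeZero (p ^ 3) := ⟨pow_ne_zero 3 (Fact.out : p.Prime).ne_zero⟩
  obtain ⟨-, h1, h2, h3, h4, h5, h6, h7, -⟩ := hconj x hx
  have hp1 : (1 : ℝ) ≤ p := by exact_mod_cast (by omega : 1 ≤ p)
  have hpow : ∀ k, k ≤ 10 → (p : ℝ) ^ k ≤ (p : ℝ) ^ 10 := fun k hk => pow_le_pow_right₀ hp1 hk
  have b2 : (fiberCount x (p ^ 3) : ℝ) ≤ (p : ℝ) ^ 8 := by
    rw [h2]
    have e1 : p ^ 6 ≤ p ^ 7 := Nat.pow_le_pow_right (by omega) (by omega)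
    have e3 : 2 * p ^ 7 ≤ p ^ 8 := by
      rw [pow_succ' p 7]; exact Nat.mul_le_mul_right _ (by omega)
    exact_mod_cast (by omega : p ^ 8 - 2 * p ^ 7 + p ^ 6 ≤ p ^ 8)
  have b4 : (fiberCount x (p ^ 4) : ℝ) ≤ (p : ℝ) ^ 5 := by
    rw [h4]
    have e1 : p ^ 3 ≤ p ^ 4 := Nat.pow_le_pow_right (by omega) (by omega)
    have e3 : 2 * p ^ 4 ≤ p ^ 5 := by
      rw [pow_succ' p 4]; exact Nat.mul_le_mul_right _ (by omega)
    exact_mod_cast (by omega : p ^ 5 - 2 * p ^ 4 + p ^ 3 ≤ p ^ 5)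
  have b6 : (fiberCount x (p ^ 5) : ℝ) ≤ (p : ℝ) ^ 2 := by
    rw [h6]
    have e3 : 2 * p ≤ p ^ 2 := by
      rw [sq]; exact Nat.mul_le_mul_right _ (by omega)
    exact_mod_cast (by omega : p ^ 2 - 2 * p + 1 ≤ p ^ 2)
  have s1 := sum_ite_reflectionPairCount_le x T (p ^ 3 - p ^ 2) (c := 2 * (p : ℝ) ^ 2)
    (A := (p : ℝ) ^ 8) (by positivity) (by rw [h1]; push_cast; rfl)
  have s2 := sum_ite_reflectionPairCount_le x T (p ^ 3) (c := 3 * (p : ℝ) ^ 2) (by positivity) b2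
  have s3 := sum_ite_reflectionPairCount_le x T (p ^ 4 - p ^ 3) (c := (p : ℝ) ^ 4)
    (A := (p : ℝ) ^ 6) (by positivity) (by rw [h3]; exact_mod_cast Nat.sub_le _ _)
  have s4 := sum_ite_reflectionPairCount_le x T (p ^ 4) (c := (p : ℝ) ^ 4) (by positivity) b4
  have s5 := sum_ite_reflectionPairCount_le x T (p ^ 5 - p ^ 4) (c := (p : ℝ) ^ 5)
    (A := (p : ℝ) ^ 3) (by positivity) (by rw [h5]; exact_mod_cast Nat.sub_le _ _)
  have s6 := sum_ite_reflectionPairCount_le x T (p ^ 5) (c := (p : ℝ) ^ 5) (by positivity) b6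
  have s7 := sum_ite_reflectionPairCount_le x T (p ^ 6 - p ^ 5) (c := (p : ℝ) ^ 6)
    (A := 1) (by positivity) (by rw [h7]; push_cast; rfl)
  have key := sum_le_sum fun y (_ : y ∈ T) => reflectionPairCount_le hp hconj hx y
  simp only [sum_add_distrib, sum_const, nsmul_eq_mul] at key
  linarith [hpow 6 (by norm_num), hpow 7 (by norm_num), hpow 8 (by norm_num),
    hpow 9 (by norm_num)]

open Finset in
theorem ncard_QPrimeAt_le [hpf : Fact p.Prime] (hp : p % 4 = 3) (hconj : KeyConjecture p)
    (P : Set (ZMod (p ^ 3) × ZMod (p ^ 3))) {d : ZMod (p ^ 3)} (hd : IsUnit d) :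
    ((QPrimeAt P d).ncard : ℝ) ≤
      ((PiPrimeAt P d).ncard : ℝ) ^ 2 / (p : ℝ) ^ 3 +
        4 * ((p : ℝ) ^ 5 * ((PiPrimeAt P d).ncard : ℝ)) := by
  classical
  have : NeZero (p ^ 3) := ⟨pow_ne_zero 3 hpf.out.ne_zero⟩
  have hp3 : 3 ≤ p := by omega
  have hp3' : (3 : ℝ) ≤ p := by exact_mod_cast hp3
  have hp0 : (0 : ℝ) < p := by linarith
  set T := (PiPrimeAt P d).toFinset with hT
  set X : Finset ((ZMod (p ^ 3) × ZMod (p ^ 3)) × (ZMod (p ^ 3) × ZMod (p ^ 3))) :=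
    {t | nrm (t.1 - t.2) = d} with hXdef
  set F : Finset (ZMod (p ^ 3) × ZMod (p ^ 3) → ZMod (p ^ 3) × ZMod (p ^ 3)) :=
    {f | IsNonIsotropicReflection f} with hF
  set act : (ZMod (p ^ 3) × ZMod (p ^ 3) → ZMod (p ^ 3) × ZMod (p ^ 3)) →
      ((ZMod (p ^ 3) × ZMod (p ^ 3)) × (ZMod (p ^ 3) × ZMod (p ^ 3))) →
      ((ZMod (p ^ 3) × ZMod (p ^ 3)) × (ZMod (p ^ 3) × ZMod (p ^ 3))) :=
    fun f t => (f t.1, f t.2) with hact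
  have hFmem : ∀ f, f ∈ F ↔ IsNonIsotropicReflection f := fun f => by simp [hF]
  have hXmem : ∀ t, t ∈ X ↔ nrm (t.1 - t.2) = d := fun t => by simp [hXdef]
  have hTmem : ∀ t, t ∈ T ↔ t ∈ PiPrimeAt P d := fun t => by simp [hT]
  have hinv : ∀ f ∈ F, Function.Involutive (act f) := fun f hf t => by
    have h := ((hFmem f).1 hf).1.involutive
    exact Prod.ext (h _) (h _)
  have hTX : T ⊆ X := fun t ht => (hXmem t).2 ((hTmem t).1 ht).2
  have hX : ∀ f ∈ F, ∀ s ∈ X, act f s ∈ X := fun f hf s hs => by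
    rw [hXmem] at hs ⊢
    rw [← hs]
    exact ((hFmem f).1 hf).1.nrm_sub _ _
  have hcardT : (PiPrimeAt P d).ncard = #T := Set.ncard_eq_toFinset_card' _
  have hcount : ∀ t t', #{f ∈ F ×ˢ F | act f.2 (act f.1 t) = t'} = reflectionPairCount t t' := by
    intro t t'
    rw [reflectionPairCount, ← Set.ncard_coe_finset]
    congr 1
    ext f
    simp [hFmem, hact, Prod.ext_iff, and_assoc]
  set g : ((ZMod (p ^ 3) × ZMod (p ^ 3)) × (ZMod (p ^ 3) × ZMod (p ^ 3))) → ℝ :=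
    fun s => (#{f ∈ F | act f s ∈ T} : ℝ) with hg
  -- Every quadruple has the form `(s, f s)` with `s, f s ∈ T` and `f ∈ F`; only this upper bound is
  -- needed, so repetitions are harmless.
  have hQ : ((QPrimeAt P d).ncard : ℝ) ≤ ∑ s ∈ T, g s := by
    have hsub : QPrimeAt P d ⊆
        ↑(T.biUnion fun s => ({f ∈ F | act f s ∈ T}).image fun f => (s, act f s)) := by
      rintro ⟨⟨x, y⟩, ⟨z, w⟩⟩ ⟨⟨hs, ht, hB, hL⟩, hd1, hd2⟩
      obtain ⟨f, hf, hxz, hyw⟩ := exists_reflection_of_bisector_eq prime_sq_ne_zero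
        (fun _ => mul_prime_sq_eq_zero) (isUnit_two hp) hB hL
      have hfa : act f (x, y) = (z, w) := Prod.ext hxz hyw
      simp only [coe_biUnion, Set.mem_iUnion, mem_coe, mem_image, mem_filter]
      refine ⟨(x, y), (hTmem _).2 ⟨hs, hd1⟩, f, ⟨(hFmem f).2 hf, ?_⟩, ?_⟩
      · rw [hfa]; exact (hTmem _).2 ⟨ht, hd2⟩
      · rw [hfa]
    have h1 := Set.ncard_le_ncard hsub (Set.toFinite _)
    rw [Set.ncard_coe_finset] at h1
    have h2 := h1.trans (card_biUnion_le.trans (sum_le_sum fun s _ => card_image_le))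
    simp only [hg]
    exact_mod_cast h2
  set D : ℝ := (p : ℝ) ^ 6 - (p : ℝ) ^ 5 with hD
  set M : ℝ := (p : ℝ) ^ 9 + (p : ℝ) ^ 8 with hM
  have hD0 : 0 ≤ D := by
    have : D = (p : ℝ) ^ 5 * (p - 1) := by rw [hD]; ring
    rw [this]
    exact mul_nonneg (by positivity) (by linarith)
  have hM0 : 0 < M := by positivity
  have hXM : (#X : ℝ) ≤ M := by
    have h := ncard_pairs_at_le hp hd
    have e : {t : (ZMod (p ^ 3) × ZMod (p ^ 3)) × (ZMod (p ^ 3) × ZMod (p ^ 3)) |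
      nrm (t.1 - t.2) = d} = ↑X := by ext t; simp [hXdef]
    rw [e, Set.ncard_coe_finset] at h
    rw [hM]
    exact_mod_cast h
  have hFD : D ≤ #F := by
    have h := le_ncard_isNonIsotropicReflection hp
    have e : {f : ZMod (p ^ 3) × ZMod (p ^ 3) → ZMod (p ^ 3) × ZMod (p ^ 3) |
        IsNonIsotropicReflection f} = ↑F := by ext f; simp [hF]
    rw [e, Set.ncard_coe_finset, Nat.mul_sub] at h
    have h' : p ^ 3 * p ^ 3 ≤ #F + p ^ 3 * p ^ 2 := by omega
    have h'' : (p : ℝ) ^ 3 * (p : ℝ) ^ 3 ≤ #F + (p : ℝ) ^ 3 * (p : ℝ) ^ 2 := by exact_mod_cast h'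
    rw [hD]
    linarith
  have h1 : D * #T ≤ ∑ s ∈ X, g s := by
    have h := sum_card_involutive_hits F act X T hinv hTX hX
    have h' : ∑ s ∈ X, g s = (#F : ℝ) * #T := by simp only [hg]; exact_mod_cast h
    rw [h']
    exact mul_le_mul_of_nonneg_right hFD (Nat.cast_nonneg _)
  have h2 : ∑ s ∈ X, g s ^ 2 ≤
      ((p : ℝ) ^ 3 - 3 * (p : ℝ) ^ 2) * (#T : ℝ) ^ 2 + (4 * (p : ℝ) ^ 5) ^ 2 * #T := by
    have h := sum_sq_card_involutive_hits F act X T hinv hTX hX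
    simp_rw [hcount] at h
    have h' : ∑ s ∈ X, g s ^ 2 = ∑ t ∈ T, ∑ t' ∈ T, (reflectionPairCount t t' : ℝ) := by
      simp only [hg]
      exact_mod_cast h
    rw [h']
    have hb : ∀ t ∈ T, ∑ t' ∈ T, (reflectionPairCount t t' : ℝ) ≤
        ((p : ℝ) ^ 3 - 3 * (p : ℝ) ^ 2) * #T + 10 * (p : ℝ) ^ 10 := fun t ht =>
      sum_reflectionPairCount_le hp3 hconj (((hTmem t).1 ht).2 ▸ hd) T
    refine (sum_le_sum hb).trans ?_
    rw [sum_const, nsmul_eq_mul]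
    -- The excess `10p¹⁰` is rounded up to `(4p⁵)² = 16p¹⁰`, which is where the constant 4 comes
    -- from.
    have : 0 ≤ (#T : ℝ) * (p : ℝ) ^ 10 := by positivity
    linarith
  -- Both sides begin `p¹² - 2p¹¹`; the coefficient 3 in the base value makes these terms agree.
  have hβ : ((p : ℝ) ^ 3 - 3 * (p : ℝ) ^ 2) * M ≤ D ^ 2 := by
    have e : D ^ 2 - ((p : ℝ) ^ 3 - 3 * (p : ℝ) ^ 2) * M = 4 * (p : ℝ) ^ 10 := by
      rw [hD, hM]; ring
    have : (0 : ℝ) ≤ 4 * (p : ℝ) ^ 10 := by positivity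
    linarith
  have hmain := sum_le_of_second_moment X T g hTX hD0 hM0 hXM h1 h2 hβ (by positivity)
  have hDM : D / M ≤ 1 / (p : ℝ) ^ 3 := by
    rw [div_le_div_iff₀ hM0 (by positivity), hD, hM]
    have : (0 : ℝ) ≤ 2 * (p : ℝ) ^ 8 := by positivity
    linarith
  rw [hcardT]
  have h3 : D / M * (#T : ℝ) ^ 2 ≤ 1 / (p : ℝ) ^ 3 * (#T : ℝ) ^ 2 :=
    mul_le_mul_of_nonneg_right hDM (by positivity)
  calc _ ≤ _ := hQ.trans hmain
    _ ≤ 1 / (p : ℝ) ^ 3 * (#T : ℝ) ^ 2 + 4 * (p : ℝ) ^ 5 * #T := by linarith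
    _ = _ := by ring

end Main

end BisectorPlane

theorem mainTheorem6 :
    ∃ C : ℝ, 0 < C ∧ ∀ p : ℕ, p.Prime → Prime (p : GaussianInt) →
      BisectorPlane.KeyConjecture p →
        ∀ (P : Set (ZMod (p ^ 3) × ZMod (p ^ 3))) (d : ZMod (p ^ 3)), IsUnit d →
          ((BisectorPlane.QPrimeAt P d).ncard : ℝ) ≤
            C * (((BisectorPlane.PiPrimeAt P d).ncard : ℝ) ^ 2 / (p : ℝ) ^ 3 +
              (p : ℝ) ^ 5 * ((BisectorPlane.PiPrimeAt P d).ncard : ℝ)) := by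
  refine ⟨4, by norm_num, fun p hp hpG hconj P d hd => ?_⟩
  have : Fact p.Prime := ⟨hp⟩
  have h := BisectorPlane.ncard_QPrimeAt_le
    (GaussianInt.mod_four_eq_three_of_nat_prime_of_prime p hpG) hconj P hd
  have h0 : 0 ≤ ((BisectorPlane.PiPrimeAt P d).ncard : ℝ) ^ 2 / (p : ℝ) ^ 3 := by positivity
  linarith
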